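/- Setting. Let $\mathcal E\subset\mathbb R^2$ be a bounded environment with pairwise disjoint regions $\mathcal S,\mathcal D,\Delta\subseteq\mathcal E$ (starting, destination and obstacle region; all sets measurable). Agents $A_1,\dots,A_n$ are disks of radii $r_i>0$, with $\hat r=\max_i r_i$, starting positions $s_i\in\mathcal S$, destinations $d_i\in\mathcal D$ and priorities $\rho_1\ge\dots\ge\rho_n$. The disks $B(s_i,r_i)$ have distance at least $2\hat r$ from each other and from $\partial\mathcal S$, and the disks $B(d_i,r_i)$ have distance at least $2\hat r$ from each other and from $\partial\mathcal D$. Let $\{\mathcal S_l\}$ and $\{\mathcal D_k\}$ be the path components of $\mathcal S$ and $\mathcal D$, and let $\mathcal S_{A_i}\ni s_i$ and $\mathcal D_{A_i}\ni d_i$ be those of agent $A_i$. For two sets put $d_{\max}(X,Y)=\sup_{x\in X,\,y\in Y}\|x-y\|_2$, except that $d_{\max}$ of a component of $\mathcal S$ (or of $\mathcal D$) and itself is $0$. Assume that 1. $d_{\max}(\mathcal S_l,\mathcal S_{l'})+d_{\max}(\mathcal D_k,\mathcal D_{k'})\le d_{\max}(\mathcal S_m,\mathcal D_q)$ for all $l,l',k,k',m,q$;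 2. the straight segment between any two points of $\mathcal S\cup\mathcal D$ lies in $\mathcal E$ (as it does when $\mathcal E$ is convex); 3. every component $C$ of $\mathcal S$ and of $\mathcal D$ is wide enough for the agents: any two positions in $C$ of a closed disk of radius $\hat r$ are joined by a continuous translation of the disk inside $C$. Put $d_{A_1}=d_{\max}(\mathcal S_{A_1},\mathcal D_{A_1})$ and, for $i\ge2$, $d_{A_i,\mathcal S}=\min_{j<i}d_{\max}(\mathcal S_{A_i},\mathcal S_{A_j})$ and $d_{A_i,\mathcal D}=\min_{j<i}d_{\max}(\mathcal D_{A_i},\mathcal D_{A_j})$. Claim. Let $1\le b<n$ be an integer with $$2d_{A_1}\hat r+\sum_{i=2}^{b}2(d_{A_i,\mathcal S}+d_{A_i,\mathcal D})\hat r\;\le\;|\mathcal E\setminus(\Delta\cup\mathcal S\cup\mathcal D)|\;<\;2d_{A_1}\hat r+\sum_{i=2}^{b+1}2(d_{A_i,\mathcal S}+d_{A_i,\mathcal D})\hat r .$$ Then offline prioritized optimization can choose an obstacle region $\Delta^*\subseteq\mathcal E\setminus(\mathcal S\cup\mathcal D)$ of the same area, $|\Delta^*|=|\Delta|$, for which there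 are continuous trajectories $p_i:[0,\infty)\to\mathbb R^2$, $p_i(0)=s_i$, of the centers of all $n$ agents, such that the agents stay in $\mathcal E$ (the open disk of radius $r_i$ about $p_i(t)$ lies in $\mathcal E$), never collide with the obstacles ($p_i(t)\notin\Delta^*$ and $p_i(t)$ has distance at least $r_i$ from $\partial\Delta^*$) or with each other ($\|p_i(t)-p_j(t)\|_2\ge r_i+r_j$ for $i\ne j$), and such that - each of the $b$ highest-priority agents $A_1,\dots,A_b$ reaches its destination in finite time and stays there; - so does each agent $A_j$ with $j>b$ for which some $i\le b$ satisfies $s_j\in\mathcal S_{A_i}$ and $d_j\in\mathcal D_{A_i}$. -/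

import Mathlib

open MeasureTheory Metric
open scoped NNReal

namespace EnvOpt

/-- The Euclidean plane. -/
abbrev Plane : Type := EuclideanSpace ℝ (Fin 2)

/-- The self-connected component of the region `R` that contains `x ∈ R`: all points of `R` that a
path inside `R` joins to `x`. (The least family of path-connected sets with union `R` is
the family of these sets.) -/
def component (R : Set Plane) (x : Plane) : Set Plane := pathComponentIn R x

/-- The maximal distance between a point of `X` and a point of `Y`. -/
noncomputable def dMax (X Y : Set Plane) : ℝ :=
  sSup {l : ℝ | ∃ x ∈ X, ∃ y ∈ Y, l = dist x y}

open Classical in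
/-- Entry of the distance matrix between the components of `R`: the maximal distance between the
components of `x` and of `y` if they differ, and `0` on the diagonal. -/
noncomputable def compDist (R : Set Plane) (x y : Plane) : ℝ :=
  if component R x = component R y then 0 else dMax (component R x) (component R y)

/-- The components of `R` are wide enough for a disk of radius `ρ`: any two positions of such a disk
inside the same component are joined by a motion of the disk inside that component. -/
def WideComponents (ρ : ℝ) (R : Set Plane) : Prop :=
  ∀ x ∈ R, ∀ y z : Plane,
    closedBall y ρ ⊆ component R x → closedBall z ρ ⊆ component R x →
      JoinedIn {w : Plane | closedBall w ρ ⊆ component R x} y z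

/-- The data of a prioritized navigation problem with `n` agents. Agents are indexed from `0`, in
order of priority, so the first `b` agents are those with `i.val < b`. -/
structure Problem (n : ℕ) where
  /-- the environment -/
  env : Set Plane
  /-- the starting region -/
  startRegion : Set Plane
  /-- the destination region -/
  destRegion : Set Plane
  /-- the initial obstacle region -/
  obstacle : Set Plane
  /-- the starting positions of the agents -/
  start : Fin n → Plane
  /-- the destinations of the agents -/
  dest : Fin n → Plane
  /-- the radii of the agents -/
  radius : Fin n → ℝ
  /-- the priorities of the agents -/
  priority : Fin n → ℝ

namespace Problem

variable {n : ℕ} (P : Problem n)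

/-- The maximal radius of the agents. -/
noncomputable def rHat : ℝ := ⨆ i, P.radius i

/-- The agents are in a bounded environment with pairwise disjoint starting, destination and
obstacle regions, start in the starting region, have their destinations in the destination
region, and are ordered by decreasing priority. -/
structure IsSetting : Prop where
  measurable_env : MeasurableSet P.env
  measurable_start : MeasurableSet P.startRegion
  measurable_dest : MeasurableSet P.destRegion
  measurable_obstacle : MeasurableSet P.obstacle
  bounded_env : Bornology.IsBounded P.env
  start_subset : P.startRegion ⊆ P.env
  dest_subset : P.destRegion ⊆ P.env
  obstacle_subset : P.obstacle ⊆ P.env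
  disjoint_start_dest : Disjoint P.startRegion P.destRegion
  disjoint_start_obstacle : Disjoint P.startRegion P.obstacle
  disjoint_dest_obstacle : Disjoint P.destRegion P.obstacle
  radius_pos : ∀ i, 0 < P.radius i
  start_mem : ∀ i, P.start i ∈ P.startRegion
  dest_mem : ∀ i, P.dest i ∈ P.destRegion
  priority_antitone : Antitone P.priority

/-- The environment contains the straight segments between points of the starting and destination
regions. -/
def StraightPathsInEnv : Prop :=
  ∀ x ∈ P.startRegion ∪ P.destRegion, ∀ y ∈ P.startRegion ∪ P.destRegion,
    segment ℝ x y ⊆ P.env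

/-- The positions `c i` of the agents in the region `R` are well separated: the agent disks have
distance at least `2 * rHat` from each other and from the boundary of `R`. -/
def WellSeparated (R : Set Plane) (c : Fin n → Plane) : Prop :=
  (∀ i j, i ≠ j → ∀ z ∈ closedBall (c i) (P.radius i), ∀ w ∈ closedBall (c j) (P.radius j),
      2 * P.rHat ≤ dist z w) ∧
  (∀ i, ∀ z ∈ closedBall (c i) (P.radius i), ∀ w ∈ frontier R, 2 * P.rHat ≤ dist z w)

/-- The sum of an entry of the distance matrix of the starting components and an entry of the
distance matrix of the destination components is at most any distance between a starting
component and a destination component. -/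
def ComponentsFarApart : Prop :=
  ∀ x ∈ P.startRegion, ∀ x' ∈ P.startRegion, ∀ y ∈ P.destRegion, ∀ y' ∈ P.destRegion,
    ∀ u ∈ P.startRegion, ∀ v ∈ P.destRegion,
      compDist P.startRegion x x' + compDist P.destRegion y y' ≤
        dMax (component P.startRegion u) (component P.destRegion v)

/-- The distance from the starting component of agent `i` to the closest starting component of an
agent of higher priority. -/
noncomputable def startDist (i : Fin n) : ℝ :=
  ⨅ j : {j : Fin n // j < i}, compDist P.startRegion (P.start i) (P.start j)

/-- The distance from the destination component of agent `i` to the closest destination component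
of an agent of higher priority. -/
noncomputable def destDist (i : Fin n) : ℝ :=
  ⨅ j : {j : Fin n // j < i}, compDist P.destRegion (P.dest i) (P.dest j)

/-- The length accounted for agent `i`: the distance between its starting and destination components
for the agent of highest priority, and `startDist i + destDist i` for the others. -/
noncomputable def legLength (i : Fin n) : ℝ :=
  if i.val = 0 then
    dMax (component P.startRegion (P.start i)) (component P.destRegion (P.dest i))
  else P.startDist i + P.destDist i

/-- The area threshold for the `k` agents of highest priority. -/
noncomputable def threshold (k : ℕ) : ℝ :=
  ∑ i : Fin n with i.val < k, 2 * P.legLength i * P.rHat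

/-- The area of the free space outside the starting, destination and obstacle regions. -/
noncomputable def freeArea : ℝ :=
  volume.real (P.env \ (P.obstacle ∪ P.startRegion ∪ P.destRegion))

/-- The obstacle regions that offline optimization may choose: they lie in the environment, do not
overlap the starting and destination regions, and have the area of the initial obstacle
region. -/
structure IsReconfiguration (Δ : Set Plane) : Prop where
  measurable : MeasurableSet Δ
  subset_env : Δ ⊆ P.env
  disjoint_start : Disjoint P.startRegion Δ
  disjoint_dest : Disjoint P.destRegion Δ
  area_eq : volume Δ = volume P.obstacle

/-- With the static obstacle region `Δ`, the trajectories `p i` of the centers of all `n` agents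
move inside the environment without any collision (touching is allowed), and each
agent in `I` reaches its destination in finite time and stays there. -/
structure CarriedOut (Δ : Set Plane) (I : Set (Fin n)) (p : Fin n → ℝ≥0 → Plane) : Prop where
  continuous : ∀ i, Continuous (p i)
  initial : ∀ i, p i 0 = P.start i
  inside_env : ∀ i t, ball (p i t) (P.radius i) ⊆ P.env
  outside_obstacle : ∀ i t, p i t ∉ Δ
  obstacle_clearance : ∀ i t, ∀ w ∈ frontier Δ, P.radius i ≤ dist (p i t) w
  agent_clearance : ∀ i j, i ≠ j → ∀ t, P.radius i + P.radius j ≤ dist (p i t) (p j t)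
  reaches : ∀ i ∈ I, ∃ T, ∀ t, T ≤ t → p i t = P.dest i

end Problem

end EnvOpt

/-! Area: moving a disk of radius `rHat` along a segment between two disks that are already free
requires only a rectangle of area `2 * length * rHat`. Agent `0` gets a corridor from its start to
its destination. Every later agent gets one corridor to the nearest earlier start component and one
to the nearest earlier destination component. These links form trees rooted at agent `0`, so the
corridors of the first `b` agents have a union `K` of area at most `threshold b` in which, together
with the two regions, each of them can go `start i` → `start 0` → `dest 0` → `dest i`
(`exists_joining_region`). Since `threshold b ≤ freeArea`, enough room remains outside this union
for obstacles of the old area (`exists_isReconfiguration`).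

Collisions: the agents move one at a time (`joinedIn_configurations_piecewise`). The clearance `2 *
rHat` around every start and destination leaves room to circle each resting agent, so the path of
the moving one can be rerouted along circles (`joinedIn_diff_iUnion_ball`). -/

namespace EnvOpt

/-! ### Measurable subsets of prescribed area -/

/-- A bounded measurable subset of the plane has measurable subsets of every smaller area. -/
theorem exists_measurable_subset_volume_eq {X : Set Plane} (hX : MeasurableSet X)
    (hb : Bornology.IsBounded X) {a : ENNReal} (ha : a ≤ volume X) :
    ∃ Y ⊆ X, MeasurableSet Y ∧ volume Y = a := by
  have hfin : volume X ≠ ⊤ := hb.measure_lt_top.ne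
  have hafin : a ≠ ⊤ := ne_top_of_le_ne_top hfin ha
  obtain ⟨R, hR⟩ := hb.subset_closedBall 0
  -- The increments of `f` are areas of `X` inside annuli, hence bounded by those of `g`. As `g` is
  -- quadratic on nonnegative radii, `f` is continuous there, and the intermediate value theorem
  -- gives the radius at which to cut `X`.
  set f : ℝ → ℝ := fun t => volume.real (X ∩ closedBall 0 t) with hf
  set g : ℝ → ℝ := fun t => volume.real (closedBall (0 : Plane) t) with hg
  have hsub : ∀ s t : ℝ, s ≤ t → f s ≤ f t ∧ f t - f s ≤ g t - g s := by
    intro s t hst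
    have hss : closedBall (0 : Plane) s ⊆ closedBall 0 t := closedBall_subset_closedBall hst
    have h1 : X ∩ closedBall 0 s ⊆ X ∩ closedBall 0 t := Set.inter_subset_inter_right X hss
    have ht : volume (closedBall (0 : Plane) t) ≠ ⊤ := measure_closedBall_lt_top.ne
    have htX : volume (X ∩ closedBall (0 : Plane) t) ≠ ⊤ := measure_inter_ne_top_of_right_ne_top ht
    refine ⟨measureReal_mono h1 htX, ?_⟩
    have e1 := measureReal_sdiff (μ := volume) h1 (hX.inter measurableSet_closedBall)
      (measure_inter_ne_top_of_right_ne_top measure_closedBall_lt_top.ne)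
    have e2 := measureReal_sdiff (μ := volume) hss measurableSet_closedBall
      measure_closedBall_lt_top.ne
    have e3 : volume.real ((X ∩ closedBall 0 t) \ (X ∩ closedBall 0 s)) ≤
        volume.real (closedBall (0 : Plane) t \ closedBall 0 s) := by
      apply measureReal_mono
      · intro x hx
        exact ⟨hx.1.2, fun h => hx.2 ⟨hx.1.1, h⟩⟩
      · exact measure_ne_top_of_subset Set.sdiff_subset ht
    simp only [hf, hg]
    linarith
  -- The area formula needs nonnegative radii; `max R 0` covers an empty `X`, where `R` may be
  -- negative.
  have hgc : ContinuousOn g (Set.Icc 0 (max R 0)) := by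
    have : Set.EqOn g (fun t => t ^ 2 * volume.real (ball (0 : Plane) 1)) (Set.Icc 0 (max R 0)) := by
      intro t ht
      have := Measure.addHaar_real_closedBall (volume : Measure Plane) 0 ht.1
      simpa [hg] using this
    exact ContinuousOn.congr (by fun_prop) this
  have hfc : ContinuousOn f (Set.Icc 0 (max R 0)) := by
    intro t ht
    have h2 := tendsto_iff_dist_tendsto_zero.1 (hgc t ht)
    refine tendsto_iff_dist_tendsto_zero.2 (squeeze_zero (fun _ => dist_nonneg) (fun s => ?_) h2)
    rw [Real.dist_eq, Real.dist_eq]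
    rcases le_total s t with h | h
    · have := hsub s t h
      rw [abs_sub_comm, abs_of_nonneg (by linarith [this.1]), abs_sub_comm (g s)]
      exact this.2.trans (le_abs_self _)
    · have := hsub t s h
      rw [abs_of_nonneg (by linarith [this.1])]
      exact this.2.trans (le_abs_self _)
  have h0 : f 0 = 0 := by
    simp only [hf, closedBall_zero]
    exact measureReal_mono_null Set.inter_subset_right (by simp [Measure.real]) (by simp)
  have h1 : f (max R 0) = volume.real X := by
    simp only [hf]
    rw [Set.inter_eq_left.2 (hR.trans (closedBall_subset_closedBall (le_max_left _ _)))]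
  obtain ⟨t, -, ht⟩ := intermediate_value_Icc (le_max_right R 0) hfc
    (show a.toReal ∈ Set.Icc (f 0) (f (max R 0)) by
      rw [h0, h1]; exact ⟨ENNReal.toReal_nonneg, ENNReal.toReal_mono hfin ha⟩)
  refine ⟨X ∩ closedBall 0 t, Set.inter_subset_left, hX.inter measurableSet_closedBall, ?_⟩
  rw [← ENNReal.toReal_eq_toReal_iff' _ hafin]
  · exact ht
  · exact measure_ne_top_of_subset Set.inter_subset_left hfin

/-! ### Rerouting paths around disks -/

/-- A path in a planar set can be rerouted around a disk of that set. -/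
theorem joinedIn_diff_ball {W : Set Plane} {x y c : Plane} {R : ℝ} (h : JoinedIn W x y)
    (hc : closedBall c R ⊆ W) (hx : x ∉ ball c R) (hy : y ∉ ball c R) :
    JoinedIn (W \ ball c R) x y := by
  obtain ⟨γ, hγ⟩ := h
  by_cases hhit : ∃ t, dist (γ t) c ≤ R
  swap
  · push Not at hhit
    exact ⟨γ, fun t => ⟨hγ t, by simpa using (hhit t).le⟩⟩
  -- The path is cut at its first time `m` in the closed disk. Were it inside the open disk at some
  -- time `s ≤ m`, it would have been at distance exactly `R` at a time `u ≤ s`; minimality of `m`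
  -- forces `u = s`, a contradiction. Applied to `γ` and to its reverse, this leaves two points of
  -- the circle, to be joined by an arc.
  have first : ∀ {x y : Plane} (γ : Path x y), (∀ t, γ t ∈ W) → (∃ t, dist (γ t) c ≤ R) →
      x ∉ ball c R → ∃ z ∈ sphere c R, JoinedIn (W \ ball c R) x z := by
    intro x y γ hγ ⟨t, ht⟩ hx
    have hcont : Continuous fun t : unitInterval => dist (γ t) c := by fun_prop
    have hcl : IsClosed {t | dist (γ t) c ≤ R} := isClosed_le hcont continuous_const
    obtain ⟨m, hm, hmin⟩ := hcl.isCompact.exists_isLeast ⟨t, ht⟩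
    have hout : ∀ s ≤ m, R ≤ dist (γ s) c := by
      intro s hs
      by_contra! hlt
      have hx' : R ≤ dist (γ 0) c := by simpa using hx
      obtain ⟨u, hu, hue⟩ := intermediate_value_Icc' (unitInterval.nonneg' : 0 ≤ s)
        hcont.continuousOn ⟨hlt.le, hx'⟩
      have h1 : m ≤ u := hmin (show dist (γ u) c ≤ R from le_of_eq hue)
      have h2 : s = u := le_antisymm (hs.trans h1) hu.2
      rw [h2] at hlt
      exact absurd hue hlt.ne
    refine ⟨γ m, le_antisymm hm (hout m le_rfl), ?_⟩
    have hJ : JoinedIn (γ '' Set.Iic m) (γ 0) (γ m) := by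
      have : JoinedIn (Set.Iic m) 0 m := by
        have hI : IsPathConnected (Set.Icc (0 : unitInterval) m) := by
          have e : Set.Icc (0 : unitInterval) m =
              (fun s : ℝ => Set.projIcc 0 1 zero_le_one s) '' Set.Icc (0 : ℝ) m := by
            ext u
            constructor
            · intro hu
              exact ⟨u, ⟨u.2.1, hu.2⟩, by simp⟩
            · rintro ⟨v, hv, rfl⟩
              have hv1 : v ∈ Set.Icc (0 : ℝ) 1 := ⟨hv.1, hv.2.trans m.2.2⟩
              simp only [Set.projIcc_of_mem _ hv1]
              exact ⟨hv.1, hv.2⟩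
          rw [e]
          exact ((convex_Icc (0 : ℝ) m).isPathConnected ⟨0, le_rfl, m.2.1⟩).image
            continuous_projIcc
        exact (hI.joinedIn 0 ⟨le_rfl, unitInterval.nonneg'⟩ m ⟨unitInterval.nonneg', le_rfl⟩).mono
          fun u hu => hu.2
      exact this.map_continuousOn γ.continuous.continuousOn
    rw [γ.source] at hJ
    refine hJ.mono ?_
    rintro _ ⟨s, hs, rfl⟩
    exact ⟨hγ s, by simpa using hout s hs⟩
  obtain ⟨z, hz, hxz⟩ := first γ hγ hhit hx
  obtain ⟨w, hw, hyw⟩ := first γ.symm (fun t => hγ _)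
    (hhit.imp' unitInterval.symm fun t ht => by simpa using ht) hy
  -- The sign of `R` is not assumed, but the circle is nonempty. It is path connected because the
  -- plane has dimension greater than one.
  have hR : 0 ≤ R := hz ▸ dist_nonneg
  have hsph : JoinedIn (sphere c R) z w :=
    (isPathConnected_sphere (by simp [← Module.finrank_eq_rank]) c hR).joinedIn z hz w hw
  refine (hxz.trans (hsph.mono fun u hu => ⟨hc (sphere_subset_closedBall hu), ?_⟩)).trans hyw.symm
  simpa using (show dist u c = R from hu).ge

/-- A path in a planar set can be rerouted around finitely many non-overlapping disks of that
set. -/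
theorem joinedIn_diff_iUnion_ball {ι : Type*} (s : Finset ι) {W : Set Plane} {x y : Plane}
    {c : ι → Plane} {R : ι → ℝ} (h : JoinedIn W x y) (hc : ∀ i ∈ s, closedBall (c i) (R i) ⊆ W)
    (hsep : ∀ i ∈ s, ∀ j ∈ s, i ≠ j → R i + R j ≤ dist (c i) (c j))
    (hx : ∀ i ∈ s, x ∉ ball (c i) (R i)) (hy : ∀ i ∈ s, y ∉ ball (c i) (R i)) :
    JoinedIn (W \ ⋃ i ∈ s, ball (c i) (R i)) x y := by
  classical
  induction s using Finset.induction_on with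
  | empty => simpa using h
  | insert a s has ih =>
    simp only [Finset.mem_insert, forall_eq_or_imp] at hc hsep hx hy
    have := joinedIn_diff_ball (c := c a) (R := R a)
      (ih hc.2 (fun i hi j hj => (hsep.2 i hi).2 j hj) hx.2 hy.2) ?_ hx.1 hy.1
    · refine this.mono fun z hz => ⟨hz.1.1, ?_⟩
      simp only [Finset.set_biUnion_insert, Set.mem_union, not_or]
      exact ⟨hz.2, hz.1.2⟩
    -- A closed disk and an open disk that at most touch are disjoint, so the new disk still lies in
    -- the set left by the earlier removals.
    · refine Set.subset_sdiff.2 ⟨hc.1, ?_⟩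
      rw [Set.disjoint_iUnion₂_right]
      intro i hi
      exact closedBall_disjoint_ball
        (hsep.1.2 i hi (by rintro rfl; exact has hi))

/-! ### Corridors swept by a moving disk -/

/-- The unit normal of the vector `v`. -/
noncomputable def unitNormal (v : Plane) : Plane := !₂[-(v 1) / ‖v‖, v 0 / ‖v‖]

/-- The rectangle with axis from `x` to `y` and half-width `r`. -/
noncomputable def corridor (x y : Plane) (r : ℝ) : Set Plane :=
  (fun q : Fin 2 → ℝ => x + (q 0 • (y - x) + q 1 • unitNormal (y - x))) ''
    Set.Icc ![0, -r] ![1, r]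

theorem norm_sq_plane (v : Plane) : ‖v‖ ^ 2 = v 0 ^ 2 + v 1 ^ 2 := by
  simp [EuclideanSpace.norm_sq_eq, Fin.sum_univ_two]

theorem norm_sq_smul_add_smul_unitNormal {v : Plane} (hv : v ≠ 0) (a b : ℝ) :
    ‖a • v + b • unitNormal v‖ ^ 2 = a ^ 2 * ‖v‖ ^ 2 + b ^ 2 := by
  have hv' : ‖v‖ ≠ 0 := norm_ne_zero_iff.2 hv
  have h := norm_sq_plane v
  rw [norm_sq_plane]
  simp only [unitNormal, PiLp.add_apply, PiLp.smul_apply, smul_eq_mul,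
    Matrix.cons_val_zero, Matrix.cons_val_one]
  field_simp
  linear_combination (-(‖v‖ ^ 2 * a ^ 2) - b ^ 2) * h

theorem eq_smul_add_smul_unitNormal {v : Plane} (hv : v ≠ 0) (p : Plane) :
    ∃ a b : ℝ, p = a • v + b • unitNormal v := by
  have hv' : ‖v‖ ≠ 0 := norm_ne_zero_iff.2 hv
  have h := norm_sq_plane v
  refine ⟨(v 0 * p 0 + v 1 * p 1) / ‖v‖ ^ 2, (-(v 1) * p 0 + v 0 * p 1) / ‖v‖, ?_⟩
  ext i
  fin_cases i
  · simp [unitNormal]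
    field_simp
    linear_combination p 0 * h
  · simp [unitNormal]
    field_simp
    linear_combination p 1 * h

theorem isCompact_corridor (x y : Plane) (r : ℝ) : IsCompact (corridor x y r) :=
  isCompact_Icc.image (by fun_prop)

/-- In coordinates the corridor is a translate of the image of a box with sides `1` and `2 * r`
under the matrix with columns `v` and its unit normal, whose determinant is `‖v‖`. -/
theorem volume_corridor {x y : Plane} (hxy : x ≠ y) (r : ℝ) :
    volume (corridor x y r) = ENNReal.ofReal (2 * dist x y * r) := by
  have hv : y - x ≠ 0 := sub_ne_zero.2 hxy.symm
  have hv' : ‖y - x‖ ≠ 0 := norm_ne_zero_iff.2 hv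
  have h := norm_sq_plane (y - x)
  set v := y - x with hvd
  set M : Matrix (Fin 2) (Fin 2) ℝ := !![v 0, unitNormal v 0; v 1, unitNormal v 1] with hM
  have hpre : WithLp.toLp 2 ⁻¹' (corridor x y r) =
      (fun q => x.ofLp + q) '' (Matrix.toLin' M '' Set.Icc ![0, -r] ![1, r]) := by
    have key : ∀ q : Fin 2 → ℝ, x + (q 0 • v + q 1 • unitNormal v) =
        WithLp.toLp 2 (x.ofLp + Matrix.toLin' M q) := by
      intro q
      ext i
      fin_cases i <;> simp [hM, dotProduct, Fin.sum_univ_two, mul_comm]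
    ext p
    simp only [corridor, Set.mem_preimage, Set.mem_image, Set.image_image, ← hvd, key]
    simp [WithLp.toLp_injective 2 |>.eq_iff]
  have hdet : LinearMap.det (Matrix.toLin' M) = ‖v‖ := by
    rw [LinearMap.det_toLin', hM, Matrix.det_fin_two_of]
    simp only [unitNormal, PiLp.toLp_apply, Matrix.cons_val_zero, Matrix.cons_val_one]
    field_simp
    linear_combination -h
  rw [← (PiLp.volume_preserving_toLp (Fin 2)).measure_preimage
    (isCompact_corridor x y r).measurableSet.nullMeasurableSet, hpre, Set.image_add_left,
    measure_preimage_add, Measure.addHaar_image_linearMap, hdet, Real.volume_Icc_pi, abs_norm,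
    Fin.prod_univ_two, dist_comm, dist_eq_norm, ← hvd]
  simp only [Matrix.cons_val_zero, Matrix.cons_val_one, sub_zero, ENNReal.ofReal_one, one_mul]
  rw [← ENNReal.ofReal_mul (norm_nonneg _)]
  ring_nf

/-- Let `a` and `b` be the coordinates of a point of the moving disk along and across the axis. If
`a < 0` the point is nearer to `x` than to `z`, if `a > 1` it is nearer to `y`, and otherwise `|b| ≤
r` puts it in the rectangle. Hence the rounded ends cost no additional area. -/
theorem ball_subset_union_corridor {x y : Plane} (hxy : x ≠ y) {r : ℝ} {z : Plane}
    (hz : z ∈ segment ℝ x y) : ball z r ⊆ ball x r ∪ ball y r ∪ corridor x y r := by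
  have hv : y - x ≠ 0 := sub_ne_zero.2 hxy.symm
  rw [segment_eq_image'] at hz
  obtain ⟨s, hs, rfl⟩ := hz
  intro q hq
  obtain ⟨a, b, hab⟩ := eq_smul_add_smul_unitNormal hv (q - x)
  have hr : 0 < r := pos_of_mem_ball hq
  have hq1 : ∀ t : ℝ, dist q (x + t • (y - x)) ^ 2 = (a - t) ^ 2 * ‖y - x‖ ^ 2 + b ^ 2 := by
    intro t
    rw [dist_eq_norm, ← norm_sq_smul_add_smul_unitNormal hv]
    congr 2
    rw [← sub_sub, hab]
    module
  have hball : ∀ t : ℝ, (a - t) ^ 2 ≤ (a - s) ^ 2 → q ∈ ball (x + t • (y - x)) r := by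
    intro t ht
    refine lt_of_le_of_lt ((pow_le_pow_iff_left₀ dist_nonneg dist_nonneg two_ne_zero).1 ?_) hq
    rw [hq1, hq1]
    gcongr
  rcases lt_or_ge a 0 with ha | ha
  · left; left
    simpa using hball 0 (by nlinarith [hs.1])
  rcases lt_or_ge 1 a with ha1 | ha1
  · left; right
    simpa using hball 1 (by nlinarith [hs.2])
  right
  have hb : |b| ≤ r := by
    apply abs_le_of_sq_le_sq _ hr.le
    have h1 := hq1 s
    have h2 : dist q (x + s • (y - x)) ^ 2 ≤ r ^ 2 :=
      pow_le_pow_left₀ dist_nonneg (mem_ball.1 hq).le 2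
    nlinarith [mul_nonneg (sq_nonneg (a - s)) (sq_nonneg ‖y - x‖)]
  refine ⟨![a, b], ?_, ?_⟩
  · rw [abs_le] at hb
    constructor <;> intro i <;> fin_cases i <;> simp [ha, ha1, hb.1, hb.2]
  · simp [← hab]

/-- The rectangle is a union of translates of the segment from `x` to `y` across its axis, and the
endpoints of each translate lie in the two end disks. -/
theorem corridor_subset_of_segment_subset {x y : Plane} (hxy : x ≠ y) {r : ℝ} {A E : Set Plane}
    (hx : closedBall x r ⊆ A) (hy : closedBall y r ⊆ A)
    (hE : ∀ z ∈ A, ∀ w ∈ A, segment ℝ z w ⊆ E) : corridor x y r ⊆ E := by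
  have hv : y - x ≠ 0 := sub_ne_zero.2 hxy.symm
  rintro _ ⟨q, ⟨h1, h2⟩, rfl⟩
  have h10 := h1 0
  have h11 := h1 1
  have h20 := h2 0
  have h21 := h2 1
  simp only [Matrix.cons_val_zero, Matrix.cons_val_one] at h10 h11 h20 h21
  have hn : ‖q 1 • unitNormal (y - x)‖ ≤ r := by
    have := norm_sq_smul_add_smul_unitNormal hv 0 (q 1)
    simp only [zero_smul, zero_add, ne_eq, OfNat.ofNat_ne_zero, not_false_eq_true, zero_pow,
      zero_mul] at this
    exact (pow_le_pow_iff_left₀ (norm_nonneg _) (by linarith) two_ne_zero).1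
      (this.trans_le (sq_le_sq' h11 h21))
  refine hE (x + q 1 • unitNormal (y - x)) (hx (by simpa [mem_closedBall, dist_eq_norm] using hn))
    (y + q 1 • unitNormal (y - x)) (hy (by simpa [mem_closedBall, dist_eq_norm] using hn)) ?_
  rw [segment_eq_image']
  exact ⟨q 0, ⟨h10, h20⟩, by simp only; module⟩

/-- If the disks of radius `r` around `x` and `y` lie in `A` and the segments between points of `A`
lie in `E`, then adding to `A` a subset of `E` of area `2 * dist x y * r` lets a disk of radius `r`
move from `x` to `y`. -/
theorem exists_joinedIn_union {x y : Plane} (hxy : x ≠ y) {r : ℝ} {A E : Set Plane}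
    (hx : closedBall x r ⊆ A) (hy : closedBall y r ⊆ A)
    (hE : ∀ z ∈ A, ∀ w ∈ A, segment ℝ z w ⊆ E) :
    ∃ K : Set Plane, MeasurableSet K ∧ K ⊆ E ∧
      volume K ≤ ENNReal.ofReal (2 * dist x y * r) ∧ JoinedIn {w | ball w r ⊆ A ∪ K} x y := by
  refine ⟨corridor x y r, (isCompact_corridor x y r).measurableSet,
    corridor_subset_of_segment_subset hxy hx hy hE, (volume_corridor hxy r).le,
    JoinedIn.of_segment_subset fun z hz => ?_⟩
  refine (ball_subset_union_corridor hxy hz).trans (Set.union_subset_union_left _ ?_)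
  exact Set.union_subset (ball_subset_closedBall.trans hx) (ball_subset_closedBall.trans hy)

/-! ### Clearance of disks from boundaries and from each other -/

/-- Off its frontier, `S` and its complement are separated by their disjoint interiors, and a
connected set cannot meet both. -/
theorem subset_of_disjoint_frontier {U S : Set Plane} (hU : IsPreconnected U)
    (hd : Disjoint U (frontier S)) (hne : (U ∩ S).Nonempty) : U ⊆ S := by
  have hcov : U ⊆ interior S ∪ interior Sᶜ := by
    intro u hu
    by_contra h
    rw [Set.mem_union, not_or] at h
    refine Set.disjoint_left.1 hd hu ⟨?_, h.1⟩
    rw [← compl_compl (closure S), ← interior_compl]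
    exact h.2
  have hint : (U ∩ interior S).Nonempty := by
    obtain ⟨u, hu, huS⟩ := hne
    refine ⟨u, hu, (hcov hu).resolve_right fun h => interior_subset h huS⟩
  exact (hU.subset_left_of_subset_union isOpen_interior isOpen_interior
    (disjoint_compl_right.mono interior_subset interior_subset) hcov hint).trans interior_subset

/-- A disk centered in `S` at distance at least `δ` from the boundary of `S` can be enlarged by `δ`
inside `S`. -/
theorem ball_subset_of_le_dist_frontier {S : Set Plane} {c : Plane} {r δ : ℝ} (hr : 0 ≤ r)
    (hδ : 0 < δ) (hc : c ∈ S) (h : ∀ z ∈ closedBall c r, ∀ w ∈ frontier S, δ ≤ dist z w) :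
    ball c (r + δ) ⊆ S := by
  refine subset_of_disjoint_frontier (convex_ball c _).isPreconnected ?_
    ⟨c, mem_ball_self (by linarith), hc⟩
  rw [Set.disjoint_left]
  intro w hw hwf
  -- The enlarged disk is the open `δ`-thickening of the closed one, so a frontier point in it would
  -- be closer than `δ` to the closed disk.
  rw [add_comm, ← thickening_closedBall hδ hr, mem_thickening_iff] at hw
  obtain ⟨z, hz, hzw⟩ := hw
  rw [dist_comm] at hzw
  exact absurd (h z hz w hwf) (not_le.2 hzw)

/-- Disks at distance at least `δ` from each other have centers that are `δ` further apart than the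
sum of their radii. -/
theorem add_le_dist_of_le_dist_closedBall {c d : Plane} {r s δ : ℝ} (hr : 0 ≤ r) (hs : 0 ≤ s)
    (hδ : 0 < δ) (h : ∀ z ∈ closedBall c r, ∀ w ∈ closedBall d s, δ ≤ dist z w) :
    r + s + δ ≤ dist c d := by
  by_contra! hlt
  -- Thickening twice: centers that are too close yield first a point `z` of one disk within `δ + s`
  -- of `d`, then a point `w` of the other within `δ` of `z`.
  have h1 : d ∈ ball c ((δ + s) + r) := by rw [mem_ball, dist_comm]; linarith
  rw [← thickening_closedBall (by linarith) hr, mem_thickening_iff] at h1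
  obtain ⟨z, hz, hdz⟩ := h1
  have h2 : z ∈ ball d (δ + s) := by rwa [mem_ball, dist_comm]
  rw [← thickening_closedBall hδ hs, mem_thickening_iff] at h2
  obtain ⟨w, hw, hzw⟩ := h2
  exact absurd (h z hz w hw) (not_le.2 hzw)

/-! ### Moving disks one after the other -/

/-- The positions of non-overlapping disks of radii `r` inside `F`. -/
def configurations {ι : Type*} (F : Set Plane) (r : ι → ℝ) : Set (ι → Plane) :=
  {q | (∀ i, ball (q i) (r i) ⊆ F) ∧ ∀ i j, i ≠ j → r i + r j ≤ dist (q i) (q j)}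

/-- If well separated disks rest in `F`, then one of them can move to any other well separated
position that it could reach if the other disks were absent. -/
theorem joinedIn_configurations_update {ι : Type*} [Finite ι] [DecidableEq ι] {F : Set Plane}
    {r : ι → ℝ} {ρ : ℝ} (hr : ∀ i, 0 < r i) (hrρ : ∀ i, r i ≤ ρ) {c : ι → Plane} {i : ι} {y : Plane}
    (hF : ∀ j, ball (c j) (r j + 2 * ρ) ⊆ F)
    (hsep : ∀ j k, j ≠ k → r j + r k + 2 * ρ ≤ dist (c j) (c k))
    (hsep' : ∀ j, j ≠ i → r j + r i + 2 * ρ ≤ dist (c j) y)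
    (hy : JoinedIn {w | ball w ρ ⊆ F} (c i) y) :
    JoinedIn (configurations F r) c (Function.update c i y) := by
  cases nonempty_fintype ι
  -- The moving center must avoid the disks of radius `r j + r i` about the resting centers. Both
  -- uses of rerouting rely on the margin `2 * ρ`: circling disk `j` sweeps points within `r j + 2 *
  -- r i ≤ r j + 2 * ρ` of `c j`, and two forbidden disks do not overlap because `(r j + r i) + (r k
  -- + r i) ≤ r j + r k + 2 * ρ`.
  have hJ : JoinedIn ({w | ball w (r i) ⊆ F} \
      ⋃ j ∈ Finset.univ.erase i, ball (c j) (r j + r i)) (c i) y := by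
    have hpos := hr i
    have hle := hrρ i
    apply joinedIn_diff_iUnion_ball
    · exact hy.mono fun w hw => (ball_subset_ball (hrρ i)).trans hw
    · intro j _ w hw
      refine (ball_subset_ball' ?_).trans (hF j)
      linarith [mem_closedBall.1 hw]
    · intro j _ k _ hjk
      linarith [hsep j k hjk]
    · intro j hj
      rw [mem_ball, dist_comm, not_lt]
      linarith [hsep j i (Finset.ne_of_mem_erase hj)]
    · intro j hj
      rw [mem_ball, dist_comm, not_lt]
      linarith [hsep' j (Finset.ne_of_mem_erase hj)]
  have hmap := hJ.map (f := Function.update c i) (continuous_const.update i continuous_id)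
  rw [Function.update_eq_self] at hmap
  refine hmap.mono ?_
  rintro _ ⟨w, ⟨hw, hwn⟩, rfl⟩
  simp only [Finset.mem_erase, Finset.mem_univ, and_true, Set.mem_iUnion, not_exists, mem_ball,
    not_lt] at hwn
  refine ⟨fun j => ?_, fun j k hjk => ?_⟩
  · rcases eq_or_ne j i with rfl | hj
    · simpa using hw
    · rw [Function.update_of_ne hj]
      exact (ball_subset_ball (by linarith [hr i, hrρ i])).trans (hF j)
  · rcases eq_or_ne j i with rfl | hj
    · rw [Function.update_self, Function.update_of_ne hjk.symm, add_comm]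
      exact hwn k hjk.symm
    · rcases eq_or_ne k i with rfl | hk
      · rw [Function.update_self, Function.update_of_ne hj, dist_comm]
        exact hwn j hj
      · rw [Function.update_of_ne hj, Function.update_of_ne hk]
        linarith [hsep j k hjk, hr i, hrρ i]

/-- Well separated disks can move, one after the other, from their positions `s` to well separated
positions `d` that each of them could reach if the other disks were absent. -/
theorem joinedIn_configurations_piecewise {ι : Type*} [Finite ι] [DecidableEq ι] {F : Set Plane}
    {r : ι → ℝ} {ρ : ℝ} (hr : ∀ i, 0 < r i) (hrρ : ∀ i, r i ≤ ρ) {s d : ι → Plane}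
    (hsF : ∀ j, ball (s j) (r j + 2 * ρ) ⊆ F) (hdF : ∀ j, ball (d j) (r j + 2 * ρ) ⊆ F)
    (hss : ∀ j k, j ≠ k → r j + r k + 2 * ρ ≤ dist (s j) (s k))
    (hdd : ∀ j k, j ≠ k → r j + r k + 2 * ρ ≤ dist (d j) (d k))
    (hsd : ∀ j k, r j + r k + 2 * ρ ≤ dist (s j) (d k)) (T : Finset ι)
    (hT : ∀ i ∈ T, JoinedIn {w | ball w ρ ⊆ F} (s i) (d i)) :
    JoinedIn (configurations F r) s (T.piecewise d s) := by
  induction T using Finset.induction_on with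
  | empty =>
    rw [Finset.piecewise_empty]
    refine JoinedIn.refl ⟨fun j => ?_, fun j k hjk => ?_⟩
    · exact (ball_subset_ball (by linarith [hr j, hrρ j])).trans (hsF j)
    · linarith [hss j k hjk, hr j, hrρ j]
  | insert a T haT ih =>
    -- Every mixed configuration of starts and destinations is again well separated, thanks to
    -- `hsd`, so the single-disk move applies at each stage.
    rw [Finset.piecewise_insert]
    refine (ih fun i hi => hT i (Finset.mem_insert_of_mem hi)).trans
      (joinedIn_configurations_update hr hrρ ?_ ?_ ?_ ?_)
    · intro j
      by_cases hj : j ∈ T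
      · rw [T.piecewise_eq_of_mem _ _ hj]
        exact hdF j
      · rw [T.piecewise_eq_of_notMem _ _ hj]
        exact hsF j
    · intro j k hjk
      by_cases hj : j ∈ T <;> by_cases hk : k ∈ T <;>
        simp only [Finset.piecewise, hj, hk, if_true, if_false]
      · exact hdd j k hjk
      · rw [dist_comm, add_comm (r j)]
        exact hsd k j
      · exact hsd j k
      · exact hss j k hjk
    · intro j hj
      by_cases hjT : j ∈ T <;> simp only [Finset.piecewise, hjT, if_true, if_false]
      · exact hdd j a hj
      · exact hsd j a
    · rw [T.piecewise_eq_of_notMem _ _ haT]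
      exact hT a (Finset.mem_insert_self a T)

/-! ### Distances and motions between components -/

/-- Points of two bounded sets are at most as far apart as the maximal distance of the sets. -/
theorem dist_le_dMax {X Y : Set Plane} (hX : Bornology.IsBounded X) (hY : Bornology.IsBounded Y)
    {x y : Plane} (hx : x ∈ X) (hy : y ∈ Y) : dist x y ≤ dMax X Y := by
  -- Boundedness matters: the real `sSup` of an unbounded set of distances would be `0`.
  obtain ⟨C, hC⟩ := (hX.union hY).subset_closedBall 0
  refine le_csSup ⟨C + C, ?_⟩ ⟨x, hx, y, hy, rfl⟩
  rintro _ ⟨u, hu, v, hv, rfl⟩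
  exact (dist_triangle_right u v 0).trans
    (add_le_add (hC (Or.inl hu)) (hC (Or.inr hv)))

/-- A disk in a region lies in the component of its center. -/
theorem closedBall_subset_component {R : Set Plane} {x : Plane} {ρ : ℝ} (hρ : 0 ≤ ρ)
    (h : closedBall x ρ ⊆ R) : closedBall x ρ ⊆ component R x :=
  ((convex_closedBall x ρ).isPathConnected ⟨x, mem_closedBall_self hρ⟩).subset_pathComponentIn
    (mem_closedBall_self hρ) h

/-- In a region with wide components, a disk can move between positions in the same component. -/
theorem joinedIn_of_component_eq {R : Set Plane} {ρ : ℝ} (hρ : 0 ≤ ρ) (hw : WideComponents ρ R)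
    {x y : Plane} (hx : closedBall x ρ ⊆ R) (hy : closedBall y ρ ⊆ R)
    (h : component R x = component R y) : JoinedIn {w | ball w ρ ⊆ R} x y := by
  refine (hw x (hx (mem_closedBall_self hρ)) x y (closedBall_subset_component hρ hx) ?_).mono
    fun w hw => ball_subset_closedBall.trans (Set.Subset.trans hw pathComponentIn_subset)
  rw [h]
  exact closedBall_subset_component hρ hy

/-- An additional area of `2 * compDist R x y * ρ` suffices for joining two components of a region
by a corridor for a disk of radius `ρ`. -/
theorem exists_joinedIn_union_of_compDist {R A E : Set Plane} {ρ : ℝ} (hρ : 0 ≤ ρ)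
    (hR : Bornology.IsBounded R) (hw : WideComponents ρ R) (hRA : R ⊆ A)
    (hE : ∀ z ∈ A, ∀ w ∈ A, segment ℝ z w ⊆ E) {x y : Plane} (hx : closedBall x ρ ⊆ R)
    (hy : closedBall y ρ ⊆ R) :
    ∃ K : Set Plane, MeasurableSet K ∧ K ⊆ E ∧
      volume K ≤ ENNReal.ofReal (2 * compDist R x y * ρ) ∧
      JoinedIn {w | ball w ρ ⊆ A ∪ K} x y := by
  -- The zero diagonal of `compDist` is justified by the width hypothesis: within one component no
  -- corridor is needed.
  by_cases h : component R x = component R y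
  · refine ⟨∅, MeasurableSet.empty, Set.empty_subset _, by simp, ?_⟩
    exact (joinedIn_of_component_eq hρ hw hx hy h).mono fun w hw =>
      Set.Subset.trans hw (hRA.trans Set.subset_union_left)
  · obtain ⟨K, hK, hKE, hvol, hJ⟩ := exists_joinedIn_union (fun hxy => h (by rw [hxy]))
      (hx.trans hRA) (hy.trans hRA) hE
    refine ⟨K, hK, hKE, hvol.trans (ENNReal.ofReal_le_ofReal ?_), hJ⟩
    rw [compDist, if_neg h]
    gcongr
    exact dist_le_dMax (hR.subset pathComponentIn_subset) (hR.subset pathComponentIn_subset)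
      (mem_pathComponentIn_self (hx (mem_closedBall_self hρ)))
      (mem_pathComponentIn_self (hy (mem_closedBall_self hρ)))

theorem compDist_nonneg (R : Set Plane) (x y : Plane) : 0 ≤ compDist R x y := by
  unfold compDist
  split_ifs
  · exact le_rfl
  · apply Real.sSup_nonneg
    rintro _ ⟨u, -, v, -, rfl⟩
    exact dist_nonneg

/-! ### Corridors, obstacle placement and trajectories for a problem -/

namespace Problem

variable {n : ℕ} {P : Problem n}

theorem radius_le_rHat (i : Fin n) : P.radius i ≤ P.rHat :=
  le_ciSup (Set.finite_range P.radius).bddAbove i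

theorem IsSetting.rHat_nonneg (hP : P.IsSetting) : 0 ≤ P.rHat :=
  Real.iSup_nonneg fun i => (hP.radius_pos i).le

theorem WellSeparated.ball_subset {R : Set Plane} {c : Fin n → Plane} (h : P.WellSeparated R c)
    (hr : ∀ i, 0 < P.radius i) (hc : ∀ i, c i ∈ R) (i : Fin n) :
    ball (c i) (P.radius i + 2 * P.rHat) ⊆ R :=
  ball_subset_of_le_dist_frontier (hr i).le (by linarith [hr i, radius_le_rHat (P := P) i]) (hc i)
    (h.2 i)

theorem WellSeparated.add_le_dist {R : Set Plane} {c : Fin n → Plane} (h : P.WellSeparated R c)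
    (hr : ∀ i, 0 < P.radius i) (i j : Fin n) (hij : i ≠ j) :
    P.radius i + P.radius j + 2 * P.rHat ≤ dist (c i) (c j) :=
  add_le_dist_of_le_dist_closedBall (hr i).le (hr j).le
    (by linarith [hr i, radius_le_rHat (P := P) i]) (h.1 i j hij)

theorem WellSeparated.closedBall_subset {R : Set Plane} {c : Fin n → Plane}
    (h : P.WellSeparated R c) (hr : ∀ i, 0 < P.radius i) (hc : ∀ i, c i ∈ R) (i : Fin n) :
    closedBall (c i) P.rHat ⊆ R :=
  (closedBall_subset_ball (by linarith [hr i, radius_le_rHat (P := P) i])).trans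
    (h.ball_subset hr hc i)

/-- For every agent there is a region of area `2 * legLength i * rHat` that joins its starting and
its destination component to components of agents of higher priority, respectively, for the agent of
highest priority, to each other. -/
theorem exists_corridors (hP : P.IsSetting) (hE : P.StraightPathsInEnv)
    (hSwide : WideComponents P.rHat P.startRegion) (hDwide : WideComponents P.rHat P.destRegion)
    (hS : P.WellSeparated P.startRegion P.start) (hD : P.WellSeparated P.destRegion P.dest)
    (i : Fin n) :
    ∃ K : Set Plane, MeasurableSet K ∧ K ⊆ P.env ∧
      volume K ≤ ENNReal.ofReal (2 * P.legLength i * P.rHat) ∧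
      (i.val = 0 → JoinedIn {w | ball w P.rHat ⊆ P.startRegion ∪ P.destRegion ∪ K}
        (P.start i) (P.dest i)) ∧
      (i.val ≠ 0 → ∃ j < i, ∃ k < i,
        JoinedIn {w | ball w P.rHat ⊆ P.startRegion ∪ P.destRegion ∪ K} (P.start i) (P.start j) ∧
        JoinedIn {w | ball w P.rHat ⊆ P.startRegion ∪ P.destRegion ∪ K} (P.dest i) (P.dest k)) := by
  have hρ := hP.rHat_nonneg
  have hSb := hP.bounded_env.subset hP.start_subset
  have hDb := hP.bounded_env.subset hP.dest_subset
  have hs := hS.closedBall_subset hP.radius_pos hP.start_mem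
  have hd := hD.closedBall_subset hP.radius_pos hP.dest_mem
  by_cases hi : i.val = 0
  · obtain ⟨K, hK, hKE, hvol, hJ⟩ := exists_joinedIn_union
      (hP.disjoint_start_dest.ne_of_mem (hP.start_mem i) (hP.dest_mem i))
      ((hs i).trans Set.subset_union_left) ((hd i).trans Set.subset_union_right) hE
    refine ⟨K, hK, hKE, hvol.trans (ENNReal.ofReal_le_ofReal ?_), fun _ => hJ,
      fun h => absurd hi h⟩
    rw [legLength, if_pos hi]
    gcongr
    exact dist_le_dMax (hSb.subset pathComponentIn_subset) (hDb.subset pathComponentIn_subset)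
      (mem_pathComponentIn_self (hP.start_mem i)) (mem_pathComponentIn_self (hP.dest_mem i))
  -- Agent `0` precedes `i`, so both infima run over nonempty finite families and are attained. The
  -- nearest agents `j` for starts and `k` for destinations may differ.
  · have : Nonempty {j : Fin n // j < i} :=
      ⟨⟨⟨0, by omega⟩, by rw [Fin.lt_def]; exact Nat.pos_of_ne_zero hi⟩⟩
    obtain ⟨⟨j, hj⟩, hjm⟩ := exists_eq_ciInf_of_finite (f := fun j : {j : Fin n // j < i} =>
      compDist P.startRegion (P.start i) (P.start j))
    obtain ⟨⟨k, hk⟩, hkm⟩ := exists_eq_ciInf_of_finite (f := fun j : {j : Fin n // j < i} =>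
      compDist P.destRegion (P.dest i) (P.dest j))
    obtain ⟨K, hK, hKE, hvol, hJ⟩ := exists_joinedIn_union_of_compDist hρ hSb hSwide
      Set.subset_union_left hE (hs i) (hs j)
    obtain ⟨K', hK', hKE', hvol', hJ'⟩ := exists_joinedIn_union_of_compDist hρ hDb hDwide
      Set.subset_union_right hE (hd i) (hd k)
    refine ⟨K ∪ K', hK.union hK', Set.union_subset hKE hKE', ?_, fun h => absurd h hi,
      fun _ => ⟨j, hj, k, hk, ?_, ?_⟩⟩
    · refine (measure_union_le K K').trans ((add_le_add hvol hvol').trans_eq ?_)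
      rw [← ENNReal.ofReal_add
        (mul_nonneg (mul_nonneg zero_le_two (compDist_nonneg _ _ _)) hρ)
        (mul_nonneg (mul_nonneg zero_le_two (compDist_nonneg _ _ _)) hρ),
        legLength, if_neg hi, startDist, destDist, ← hjm, ← hkm]
      ring_nf
    · exact hJ.mono fun w hw => Set.Subset.trans hw
        (Set.union_subset_union_right _ Set.subset_union_left)
    · exact hJ'.mono fun w hw => Set.Subset.trans hw
        (Set.union_subset_union_right _ Set.subset_union_right)

theorem legLength_nonneg (i : Fin n) : 0 ≤ P.legLength i := by
  unfold legLength
  split_ifs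
  · apply Real.sSup_nonneg
    rintro _ ⟨u, -, v, -, rfl⟩
    exact dist_nonneg
  · exact add_nonneg (Real.iInf_nonneg fun _ => compDist_nonneg _ _ _)
      (Real.iInf_nonneg fun _ => compDist_nonneg _ _ _)

/-- The corridors of the first `b` agents connect all their starting and destination components. -/
theorem exists_joining_region {b : ℕ} (hP : P.IsSetting) (hE : P.StraightPathsInEnv)
    (hSwide : WideComponents P.rHat P.startRegion) (hDwide : WideComponents P.rHat P.destRegion)
    (hS : P.WellSeparated P.startRegion P.start) (hD : P.WellSeparated P.destRegion P.dest) :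
    ∃ K : Set Plane, MeasurableSet K ∧ K ⊆ P.env ∧
      volume K ≤ ENNReal.ofReal (P.threshold b) ∧
      ∀ i : Fin n, i.val < b →
        JoinedIn {w | ball w P.rHat ⊆ P.startRegion ∪ P.destRegion ∪ K} (P.start i) (P.dest i) := by
  choose K hK hKE hvol hzero hsucc using exists_corridors hP hE hSwide hDwide hS hD
  have hsub : ∀ i : Fin n, i.val < b →
      {w | ball w P.rHat ⊆ P.startRegion ∪ P.destRegion ∪ K i} ⊆ {w | ball w P.rHat ⊆
        P.startRegion ∪ P.destRegion ∪ ⋃ j ∈ Finset.univ.filter fun j : Fin n => j.val < b, K j} :=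
    fun i hi w hw => Set.Subset.trans hw (Set.union_subset_union_right _
      (Set.subset_biUnion_of_mem (u := K)
        (Finset.mem_coe.2 (Finset.mem_filter.2 ⟨Finset.mem_univ i, hi⟩))))
  refine ⟨⋃ j ∈ Finset.univ.filter fun j : Fin n => j.val < b, K j,
    Finset.measurableSet_biUnion _ fun j _ => hK j, Set.iUnion₂_subset fun j _ => hKE j, ?_, ?_⟩
  · rw [threshold, ENNReal.ofReal_sum_of_nonneg fun i _ =>
      mul_nonneg (mul_nonneg zero_le_two (legLength_nonneg i)) hP.rHat_nonneg]
    exact (measure_biUnion_finset_le _ _).trans (Finset.sum_le_sum fun i _ => hvol i)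
  -- Strong induction along the links: each leads to a smaller index, hence one still below `b`,
  -- until agent `0` is reached.
  · have hroot : ∀ m : ℕ, ∀ i z : Fin n, i.val = m → z.val = 0 → i.val < b →
        JoinedIn {w | ball w P.rHat ⊆ P.startRegion ∪ P.destRegion ∪
          ⋃ j ∈ Finset.univ.filter fun j : Fin n => j.val < b, K j} (P.start i) (P.start z) ∧
        JoinedIn {w | ball w P.rHat ⊆ P.startRegion ∪ P.destRegion ∪
          ⋃ j ∈ Finset.univ.filter fun j : Fin n => j.val < b, K j} (P.dest i) (P.dest z) := by
      intro m
      induction m using Nat.strong_induction_on with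
      | _ m ih =>
        intro i z him hz hib
        by_cases hi : i.val = 0
        · have hiz : i = z := Fin.ext (hi.trans hz.symm)
          have h := (hzero i hi).mono (hsub i hib)
          rw [← hiz]
          exact ⟨JoinedIn.refl h.source_mem, JoinedIn.refl h.target_mem⟩
        · obtain ⟨j, hj, k, hk, hJ, hJ'⟩ := hsucc i hi
          rw [Fin.lt_def] at hj hk
          exact ⟨(hJ.mono (hsub i hib)).trans (ih j (him ▸ hj) j z rfl hz (hj.trans hib)).1,
            (hJ'.mono (hsub i hib)).trans (ih k (him ▸ hk) k z rfl hz (hk.trans hib)).2⟩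
    intro i hi
    have hn : 0 < n := i.pos
    obtain ⟨h1, h2⟩ := hroot i i ⟨0, hn⟩ rfl rfl hi
    -- The trees of starts and of destinations are connected to each other only through the corridor
    -- of agent `0`.
    exact (h1.trans ((hzero ⟨0, hn⟩ rfl).mono (hsub _ (show 0 < b by omega)))).trans h2.symm

/-- Obstacles of the prescribed area fit outside any region whose area is at most the free area. -/
theorem exists_isReconfiguration (hP : P.IsSetting) {K : Set Plane} (hK : MeasurableSet K)
    (hvol : volume K ≤ ENNReal.ofReal P.freeArea) :
    ∃ Δ, P.IsReconfiguration Δ ∧ Disjoint Δ (P.startRegion ∪ P.destRegion ∪ K) := by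
  have hSD := hP.measurable_start.union hP.measurable_dest
  have hX : MeasurableSet (P.env \ (P.startRegion ∪ P.destRegion ∪ K)) :=
    hP.measurable_env.diff (hSD.union hK)
  have hKfin : volume K ≠ ⊤ := ne_top_of_le_ne_top ENNReal.ofReal_ne_top hvol
  have hle : volume P.obstacle ≤ volume (P.env \ (P.startRegion ∪ P.destRegion ∪ K)) := by
    have hfree : volume (P.env \ (P.obstacle ∪ P.startRegion ∪ P.destRegion)) =
        ENNReal.ofReal P.freeArea :=
      (ofReal_measureReal (measure_ne_top_of_subset Set.sdiff_subset
        hP.bounded_env.measure_lt_top.ne)).symm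
    -- The old obstacles and the free space fill the environment outside the two regions, which is
    -- covered by the new available space and `K`. Cancelling the area of `K`, at most the free
    -- area, leaves room for the obstacles. `K` may cross the old obstacles, as these are relocated.
    have hsplit : volume P.obstacle +
        volume (P.env \ (P.obstacle ∪ P.startRegion ∪ P.destRegion)) ≤
        volume (P.env \ (P.startRegion ∪ P.destRegion ∪ K)) + volume K := by
      rw [← measure_union _ (hP.measurable_env.diff
        ((hP.measurable_obstacle.union hP.measurable_start).union hP.measurable_dest))]
      · refine (measure_mono ?_).trans (measure_union_le _ _)
        intro x hx
        by_cases hxK : x ∈ K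
        · exact Or.inr hxK
        · left
          rcases hx with hx | ⟨hxE, hx⟩
          · refine ⟨hP.obstacle_subset hx, ?_⟩
            rintro ((h | h) | h)
            · exact Set.disjoint_left.1 hP.disjoint_start_obstacle h hx
            · exact Set.disjoint_left.1 hP.disjoint_dest_obstacle h hx
            · exact hxK h
          · refine ⟨hxE, ?_⟩
            rintro ((h | h) | h)
            · exact hx (Or.inl (Or.inr h))
            · exact hx (Or.inr h)
            · exact hxK h
      · rw [Set.disjoint_left]
        exact fun x hx h => h.2 (Or.inl (Or.inl hx))
    rw [hfree] at hsplit
    exact ENNReal.le_of_add_le_add_right hKfin ((add_le_add_right hvol _).trans hsplit)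
  obtain ⟨Δ, hΔ, hΔm, hΔv⟩ := exists_measurable_subset_volume_eq hX
    (hP.bounded_env.subset Set.sdiff_subset) hle
  obtain ⟨hΔE, hdisj⟩ := Set.subset_sdiff.1 hΔ
  rw [Set.union_assoc, Set.disjoint_union_right, Set.disjoint_union_right] at hdisj
  exact ⟨Δ, ⟨hΔm, hΔE, hdisj.1.symm, hdisj.2.1.symm, hΔv⟩, (Set.subset_sdiff.1 hΔ).2⟩

/-- A motion through the configurations of the agent disks in an obstacle-free region yields
trajectories of the agents. -/
theorem exists_carriedOut {Δ F : Set Plane} {I : Set (Fin n)} (hr : ∀ i, 0 < P.radius i)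
    (hFE : F ⊆ P.env) (hΔF : Disjoint Δ F) {e : Fin n → Plane} (he : ∀ i ∈ I, e i = P.dest i)
    (h : JoinedIn (configurations F P.radius) P.start e) : ∃ p, P.CarriedOut Δ I p := by
  obtain ⟨γ, hγ⟩ := h
  have hconf : ∀ t : ℝ≥0, γ.extend t ∈ configurations F P.radius := by
    intro t
    obtain ⟨u, hu⟩ : γ.extend t ∈ Set.range γ := γ.extend_range ▸ Set.mem_range_self _
    exact hu ▸ hγ u
  have hdisj : ∀ i (t : ℝ≥0), Disjoint (ball (γ.extend t i) (P.radius i)) Δ := fun i t =>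
    (hΔF.mono_right ((hconf t).1 i)).symm
  refine ⟨fun i t => γ.extend t i, fun i => ?_, fun i => ?_, fun i t => ((hconf t).1 i).trans hFE,
    fun i t => ?_, fun i t w hw => ?_, fun i j hij t => (hconf t).2 i j hij, fun i hi => ?_⟩
  · exact (continuous_apply i).comp (γ.continuous_extend.comp NNReal.continuous_coe)
  · simp
  · exact Set.disjoint_left.1 (hdisj i t) (mem_ball_self (hr i))
  -- An open disk disjoint from `Δ` is disjoint from its closure, hence from its frontier.
  · by_contra! hlt
    rw [dist_comm] at hlt
    exact Set.disjoint_left.1 ((hdisj i t).closure_right isOpen_ball) hlt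
      (frontier_subset_closure hw)
  -- The path on the unit interval is extended by constants, so time `1` serves all agents.
  · refine ⟨1, fun t ht => ?_⟩
    rw [γ.extend_of_one_le (by exact_mod_cast ht), he i hi]

end Problem

end EnvOpt

/-! ### Combining area and motion -/

theorem corollary1 {n b : ℕ} (hb : 1 ≤ b) (hbn : b < n) (P : EnvOpt.Problem n)
    (hP : P.IsSetting) (hE : P.StraightPathsInEnv)
    (hSwide : EnvOpt.WideComponents P.rHat P.startRegion)
    (hDwide : EnvOpt.WideComponents P.rHat P.destRegion)
    (hS : P.WellSeparated P.startRegion P.start)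
    (hD : P.WellSeparated P.destRegion P.dest)
    (hfar : P.ComponentsFarApart)
    (hlower : P.threshold b ≤ P.freeArea) (hupper : P.freeArea < P.threshold (b + 1)) :
    ∃ Δ : Set EnvOpt.Plane, P.IsReconfiguration Δ ∧
      ∃ p : Fin n → ℝ≥0 → EnvOpt.Plane,
        P.CarriedOut Δ
          ({i | i.val < b} ∪
            {j | ∃ i : Fin n, i.val < b ∧
              P.start j ∈ EnvOpt.component P.startRegion (P.start i) ∧
              P.dest j ∈ EnvOpt.component P.destRegion (P.dest i)}) p := by
  classical
  have hr := hP.radius_pos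
  obtain ⟨K, hK, hKE, hvol, hJ⟩ :=
    EnvOpt.Problem.exists_joining_region (b := b) hP hE hSwide hDwide hS hD
  obtain ⟨Δ, hΔ, hdisj⟩ := EnvOpt.Problem.exists_isReconfiguration hP hK
    (hvol.trans (ENNReal.ofReal_le_ofReal hlower))
  have hsb := hS.ball_subset hr hP.start_mem
  have hdb := hD.ball_subset hr hP.dest_mem
  have hSF : P.startRegion ⊆ P.startRegion ∪ P.destRegion ∪ K :=
    Set.subset_union_left.trans Set.subset_union_left
  have hDF : P.destRegion ⊆ P.startRegion ∪ P.destRegion ∪ K :=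
    Set.subset_union_right.trans Set.subset_union_left
  -- No separation between starts and destinations is assumed; it follows because the enlarged disks
  -- lie in disjoint regions.
  have hsd : ∀ j k, P.radius j + P.radius k + 2 * P.rHat ≤ dist (P.start j) (P.dest k) := by
    intro j k
    have hρ := hP.rHat_nonneg
    have := (disjoint_ball_ball_iff (by linarith [hr j]) (by linarith [hr k])).1
      (hP.disjoint_start_dest.mono (hsb j) (hdb k))
    linarith
  -- All agents whose destination is reachable in the obstacle-free region move; the others rest at
  -- their starts forever.
  refine ⟨Δ, hΔ, EnvOpt.Problem.exists_carriedOut (e := Finset.piecewise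
    (Finset.univ.filter fun i => JoinedIn
      {w | ball w P.rHat ⊆ P.startRegion ∪ P.destRegion ∪ K} (P.start i) (P.dest i))
    P.dest P.start) hr
    (Set.union_subset (Set.union_subset hP.start_subset hP.dest_subset) hKE) hdisj ?_
    (EnvOpt.joinedIn_configurations_piecewise hr EnvOpt.Problem.radius_le_rHat
      (fun j => (hsb j).trans hSF) (fun j => (hdb j).trans hDF) (hS.add_le_dist hr)
      (hD.add_le_dist hr) hsd _ fun i hi => (Finset.mem_filter.1 hi).2)⟩
  intro j hj
  refine Finset.piecewise_eq_of_mem _ _ _ (Finset.mem_filter.2 ⟨Finset.mem_univ j, ?_⟩)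
  rcases hj with hj | ⟨i, hi, hjs, hjd⟩
  · exact hJ j hj
  · have hs := hS.closedBall_subset hr hP.start_mem
    have hd := hD.closedBall_subset hr hP.dest_mem
    -- An agent sharing both components with some `i < b` follows its route: `start j` → `start i` →
    -- `dest i` → `dest j`, with the outer legs inside the wide components.
    have h1 := EnvOpt.joinedIn_of_component_eq hP.rHat_nonneg hSwide (hs j) (hs i)
      (pathComponentIn_congr hjs)
    have h2 := EnvOpt.joinedIn_of_component_eq hP.rHat_nonneg hDwide (hd i) (hd j)
      (pathComponentIn_congr hjd).symm
    exact ((h1.mono fun w hw => Set.Subset.trans hw hSF).trans (hJ i hi)).trans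
      (h2.mono fun w hw => Set.Subset.trans hw hDF)
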